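/- Let $\mathfrak H_0$ be a complex Hilbert space, let $A_0$ be a bounded self-adjoint operator on $\mathfrak H_0$, let $A_1$ be a self-adjoint operator on $\mathfrak H_1=\mathbb C$, and let $V:\mathbb C\to\mathfrak H_0$ be a bounded linear operator. Let $$\mathbf B=\begin{pmatrix}A_0&V\\V^*&A_1\end{pmatrix}$$ on the orthogonal sum $\mathfrak H=\mathfrak H_0\oplus\mathbb C$. Let $a_1\in\mathbb R$ be the number such that $A_1$ is multiplication by $a_1$, and let $v\in\mathfrak H_0$ be the vector with $V^*x=\langle v,x\rangle$ for all $x\in\mathfrak H_0$ (the inner product is linear in the second argument), that is, $v=V1$. Assume that $\mathfrak H_0$ is the cyclic subspace of $A_0$ generated by $\operatorname{Ran}V$, i.e. the closed linear span of the vectors $A_0^nv$, $n\ge0$. Then $$\phi(z)=\frac{1+(a_1-z)\langle v,(A_0-z)^{-1}v\rangle}{(a_1-z)-\langle v,(A_0-z)^{-1}v\rangle}$$ has a non-vanishing denominator for all $z\in\mathbb C\setminus\mathbb R$ and is a Herglotz function (it is holomorphic in the open upper half-plane and maps it into itself), and there is a positive Borel measure $\omega$ on $\mathbb R$ with compact support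 and total mass $\omega(\mathbb R)=1+\|v\|^2$ such that $$\phi(z)=\int_{\mathbb R}\frac{d\omega(\lambda)}{\lambda-z}\qquad\text{for all }z\in\mathbb C\setminus\mathbb R.$$ Moreover, for this $\omega$, the operator $\mathbf B$ is unitarily equivalent to the operator of multiplication by the independent variable on $L^2(\mathbb R,\omega)$. -/

import Mathlib

open MeasureTheory

noncomputable section

/-- The block operator `[[A₀, V], [V*, A₁]]` on the Hilbert space direct sum `H₀ ⊕ H₁`. -/
def blockOperator {H₀ H₁ : Type*}
    [NormedAddCommGroup H₀] [InnerProductSpace ℂ H₀] [CompleteSpace H₀]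
    [NormedAddCommGroup H₁] [InnerProductSpace ℂ H₁] [CompleteSpace H₁]
    (A₀ : H₀ →L[ℂ] H₀) (A₁ : H₁ →L[ℂ] H₁) (V : H₁ →L[ℂ] H₀) :
    WithLp 2 (H₀ × H₁) →L[ℂ] WithLp 2 (H₀ × H₁) :=
  (WithLp.prodContinuousLinearEquiv 2 ℂ H₀ H₁).symm.toContinuousLinearMap ∘L
    (((A₀ ∘L ContinuousLinearMap.fst ℂ H₀ H₁ + V ∘L ContinuousLinearMap.snd ℂ H₀ H₁).prod
      (ContinuousLinearMap.adjoint V ∘L ContinuousLinearMap.fst ℂ H₀ H₁ +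
        A₁ ∘L ContinuousLinearMap.snd ℂ H₀ H₁)) ∘L
    (WithLp.prodContinuousLinearEquiv 2 ℂ H₀ H₁).toContinuousLinearMap)

theorem blockOperator_toLp {H₀ H₁ : Type*}
    [NormedAddCommGroup H₀] [InnerProductSpace ℂ H₀] [CompleteSpace H₀]
    [NormedAddCommGroup H₁] [InnerProductSpace ℂ H₁] [CompleteSpace H₁]
    (A₀ : H₀ →L[ℂ] H₀) (A₁ : H₁ →L[ℂ] H₁) (V : H₁ →L[ℂ] H₀) (x : H₀) (y : H₁) :
    blockOperator A₀ A₁ V (WithLp.toLp 2 (x, y)) =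
      WithLp.toLp 2 (A₀ x + V y, ContinuousLinearMap.adjoint V x + A₁ y) := rfl

/-- The cyclic subspace of a bounded self-adjoint operator `A` generated by the subspace `S`:
the closed linear span of all vectors `Aⁿ s` with `s ∈ S` and `n ≥ 0`. -/
def cyclicSubspace {H : Type*} [NormedAddCommGroup H] [InnerProductSpace ℂ H]
    (A : H →L[ℂ] H) (S : Submodule ℂ H) : Submodule ℂ H :=
  (Submodule.span ℂ {x : H | ∃ (n : ℕ) (s : H), s ∈ S ∧ x = (A ^ n) s}).topologicalClosure

/-- The real number `a₁` such that the self-adjoint operator `A₁` on `ℂ` is multiplication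
by `a₁`. -/
def multiplier (A₁ : ℂ →L[ℂ] ℂ) : ℝ := (A₁ 1).re

theorem apply_eq_multiplier_mul (A₁ : ℂ →L[ℂ] ℂ) (hA₁ : IsSelfAdjoint A₁) (c : ℂ) :
    A₁ c = (multiplier A₁ : ℂ) * c := by
  have h : inner ℂ (A₁ 1) (1 : ℂ) = inner ℂ (1 : ℂ) (A₁ 1) := by
    have := ContinuousLinearMap.adjoint_inner_left A₁ (1 : ℂ) (1 : ℂ)
    rwa [← ContinuousLinearMap.star_eq_adjoint, hA₁.star_eq] at this
  have h' : ((A₁ 1).re : ℂ) = A₁ 1 := by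
    apply Complex.conj_eq_iff_re.mp
    simpa using h
  have h2 : A₁ c = c * A₁ 1 := by simpa using A₁.map_smul c 1
  rw [h2, multiplier, h', mul_comm]

/-- The vector `v` that represents `V : ℂ → H₀`, that is `V* x = ⟨v, x⟩` for all `x`. -/
def couplingVector {H₀ : Type*} [NormedAddCommGroup H₀] [InnerProductSpace ℂ H₀]
    (V : ℂ →L[ℂ] H₀) : H₀ := V 1

theorem adjoint_apply_eq_inner_couplingVector {H₀ : Type*} [NormedAddCommGroup H₀]
    [InnerProductSpace ℂ H₀] [CompleteSpace H₀] (V : ℂ →L[ℂ] H₀) (x : H₀) :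
    ContinuousLinearMap.adjoint V x = inner ℂ (couplingVector V) x := by
  have := ContinuousLinearMap.adjoint_inner_right V (1 : ℂ) x
  simpa [couplingVector] using this

/-- The scalar function `z ↦ ⟨v, (A₀ - z)⁻¹ v⟩`, for `z` outside the spectrum of `A₀`. -/
def resolventForm {H₀ : Type*} [NormedAddCommGroup H₀] [InnerProductSpace ℂ H₀]
    (A₀ : H₀ →L[ℂ] H₀) (v : H₀) (z : ℂ) : ℂ :=
  inner ℂ v (Ring.inverse (A₀ - z • ContinuousLinearMap.id ℂ H₀) v)

/-- The function
`φ(z) = (1 + (a₁ - z) ⟨v, (A₀ - z)⁻¹ v⟩) / ((a₁ - z) - ⟨v, (A₀ - z)⁻¹ v⟩)`. -/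
def phi {H₀ : Type*} [NormedAddCommGroup H₀] [InnerProductSpace ℂ H₀]
    (A₀ : H₀ →L[ℂ] H₀) (a₁ : ℝ) (v : H₀) (z : ℂ) : ℂ :=
  (1 + ((a₁ : ℂ) - z) * resolventForm A₀ v z) / (((a₁ : ℂ) - z) - resolventForm A₀ v z)

/-- A Herglotz function: holomorphic in the open upper half-plane, which it maps into itself. -/
def IsHerglotz (f : ℂ → ℂ) : Prop :=
  DifferentiableOn ℂ f {z : ℂ | 0 < z.im} ∧ ∀ z : ℂ, 0 < z.im → 0 < (f z).im

/-- The everywhere defined operator `B` is unitarily equivalent to the operator of multiplication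
by the independent variable in `L²(ℝ, ω)`. As the unitary `U` is onto, this includes that the
multiplication operator is everywhere defined. -/
def IsUnitarilyEquivalentToMul {H : Type*} [NormedAddCommGroup H] [InnerProductSpace ℂ H]
    (B : H →L[ℂ] H) (ω : Measure ℝ) : Prop :=
  ∃ U : H ≃ₗᵢ[ℂ] Lp ℂ 2 ω, ∀ x : H, U (B x) =ᵐ[ω] fun t : ℝ => (t : ℂ) * U x t

end

/-! Put e = (0, 1), so that w = (v, i) = (B - (a₁ - i))e, where B is the block operator. Eliminating
the H₀ component from (B - z)y = w gives ⟨w, (B - z)⁻¹w⟩ = φ(z), so φ should be the Cauchy transform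
of the spectral measure ω of w, whose mass is ‖w‖² = 1 + ‖v‖². The Herglotz property follows from
Im⟨w, y⟩ = Im z · ‖y‖².

The vector e is cyclic for B because v is cyclic for A₀, and w inherits this because a₁ ± i is not
in the spectrum of B. The spectral theorem for a cyclic vector then gives a unitary onto L²(ω) that
sends w to 1 and B to multiplication by t. The carrying lemmas are `exists_unitary_mul_of_cyclic`,
`exists_blockOperator_sub_smul_eq` and `blockCyclicVector_cyclic`. -/

noncomputable section

/-! ### Spectral theorem for a self-adjoint operator with a cyclic vector -/

section SpectralTheorem

open scoped CompactlySupported BoundedContinuousFunction ENNReal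

variable {H : Type*} [NormedAddCommGroup H] [InnerProductSpace ℂ H] [CompleteSpace H]

/-- For a representation `T` of the continuous functions on a compact space and a vector `x`, the
seminorm `f ↦ ‖T f x‖` is the `L²` seminorm of a finite measure. -/
theorem exists_measure_norm_sq_starAlgHom {X : Type*} [TopologicalSpace X] [CompactSpace X]
    [T2Space X] [MeasurableSpace X] [BorelSpace X] (T : C(X, ℂ) →⋆ₐ[ℂ] (H →L[ℂ] H)) (x : H) :
    ∃ μ : Measure X, IsFiniteMeasure μ ∧
      ∀ f : C(X, ℂ), ‖T f x‖ ^ 2 = ∫ t, ‖f t‖ ^ 2 ∂μ := by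
  let j : C(X, ℝ) →ₗ[ℝ] C(X, ℂ) :=
    { toFun := fun f => ⟨fun t => (f t : ℂ), by fun_prop⟩
      map_add' := fun f g => by ext; simp
      map_smul' := fun c f => by ext; simp }
  have key : ∀ f : C(X, ℂ), inner ℂ x (T (star f * f) x) = (‖T f x‖ ^ 2 : ℝ) := by
    intro f
    rw [map_mul, map_star, mul_apply_eq_comp, ContinuousLinearMap.star_eq_adjoint,
      ContinuousLinearMap.adjoint_inner_right, inner_self_eq_norm_sq_to_K]
    simp
  let Λ₀ : C_c(X, ℝ) →ₗ[ℝ] ℝ :=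
    { toFun := fun f => (inner ℂ x (T (j f.toContinuousMap) x)).re
      map_add' := fun f g => by
        have : (f + g).toContinuousMap = f.toContinuousMap + g.toContinuousMap := rfl
        rw [this, map_add, map_add, add_apply, inner_add_right, Complex.add_re]
      map_smul' := fun c f => by
        have : j (c • f).toContinuousMap = (c : ℂ) • j f.toContinuousMap := by ext; simp [j]
        rw [this, map_smul, smul_apply, inner_smul_right]
        simp }
  have hΛ : ∀ f : C_c(X, ℝ), 0 ≤ f → 0 ≤ Λ₀ f := by
    intro f hf
    -- Positivity: f = s* s with s = √f, so the functional takes the value ‖T(s)x‖².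
    let s : C(X, ℂ) := j ⟨fun t => Real.sqrt (f t), by fun_prop⟩
    have : j f.toContinuousMap = star s * s := by
      ext t
      have h : 0 ≤ f t := hf t
      simp [s, j, ← Complex.ofReal_mul, Real.mul_self_sqrt h]
    change 0 ≤ (inner ℂ x (T (j f.toContinuousMap) x)).re
    rw [this, key, Complex.ofReal_re]
    positivity
  let Λ : C_c(X, ℝ) →ₚ[ℝ] ℝ := PositiveLinearMap.mk₀ Λ₀ hΛ
  refine ⟨RealRMK.rieszMeasure Λ, inferInstance, fun f => ?_⟩
  let g : C_c(X, ℝ) := CompactlySupportedContinuousMap.continuousMapEquiv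
    ⟨fun t => ‖f t‖ ^ 2, by fun_prop⟩
  have h1 := RealRMK.integral_rieszMeasure Λ g
  have h2 : Λ g = ‖T f x‖ ^ 2 := by
    change (inner ℂ x (T (j g.toContinuousMap) x)).re = _
    have : j g.toContinuousMap = star f * f := by
      ext t
      simp [g, j, Complex.conj_mul']
    rw [this, key, Complex.ofReal_re]
  rw [← h2, ← h1]
  rfl

/-- The identity function on `ℝ`, truncated to `[-M, M]`. -/
def truncatedId (M : ℝ) : ℝ →ᵇ ℂ :=
  BoundedContinuousFunction.ofNormedAddCommGroup
    (fun t => ((max (-|M|) (min t |M|) : ℝ) : ℂ)) (by fun_prop) |M| (fun t => by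
      rw [Complex.norm_real, Real.norm_eq_abs, abs_le]
      exact ⟨le_max_left _ _, max_le (by linarith [abs_nonneg M]) (min_le_right _ _)⟩)

theorem truncatedId_apply_of_abs_le {M t : ℝ} (h : |t| ≤ M) : truncatedId M t = t := by
  have hM : |M| = M := abs_of_nonneg ((abs_nonneg t).trans h)
  obtain ⟨h1, h2⟩ := abs_le.mp h
  simp [truncatedId, hM, min_eq_left h2, max_eq_right h1]

/-- Multiplication by a bounded continuous function, as an operator on `L²`. -/
def lpMul (ω : Measure ℝ) [IsFiniteMeasure ω] (c : ℝ →ᵇ ℂ) : Lp ℂ 2 ω →L[ℂ] Lp ℂ 2 ω :=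
  (ContinuousLinearMap.mul ℂ ℂ).holderL ω ∞ 2 2 (BoundedContinuousFunction.toLp ∞ ω ℂ c)

theorem coeFn_lpMul (ω : Measure ℝ) [IsFiniteMeasure ω] (c : ℝ →ᵇ ℂ) (F : Lp ℂ 2 ω) :
    lpMul ω c F =ᵐ[ω] fun t => c t * F t := by
  have h1 := (ContinuousLinearMap.mul ℂ ℂ).coeFn_holder (r := 2)
    (BoundedContinuousFunction.toLp ∞ ω ℂ c) F
  filter_upwards [h1, BoundedContinuousFunction.coeFn_toLp ∞ ω ℂ c] with t ht hc
  rw [hc] at ht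
  exact ht

/-- The spectral theorem for a bounded self-adjoint operator with a cyclic vector. -/
theorem exists_unitary_mul_of_cyclic (B : H →L[ℂ] H) (hB : IsSelfAdjoint B) (x : H)
    (hx : (Submodule.span ℂ (Set.range fun n : ℕ => (B ^ n) x)).topologicalClosure = ⊤) :
    ∃ ω : Measure ℝ, IsFiniteMeasure ω ∧ IsCompact ω.support ∧
      ∃ U : H ≃ₗᵢ[ℂ] Lp ℂ 2 ω, (U x =ᵐ[ω] fun _ => 1) ∧
        ∀ y, U (B y) =ᵐ[ω] fun t : ℝ => (t : ℂ) * U y t := by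
  have hBn : IsStarNormal B := hB.isStarNormal
  let X := spectrum ℂ B
  let T : C(X, ℂ) →⋆ₐ[ℂ] (H →L[ℂ] H) := cfcHom hBn
  have hT : T ((ContinuousMap.id ℂ).restrict X) = B := cfcHom_id hBn
  have : CompactSpace X := isCompact_iff_compactSpace.mp (spectrum.isCompact B)
  obtain ⟨μ, hμ, hTμ⟩ := exists_measure_norm_sq_starAlgHom T x
  have hcont : Continuous (fun z : X => (z : ℂ).re) := by fun_prop
  let ω := μ.map (fun z : X => (z : ℂ).re)
  have hω : IsFiniteMeasure ω := by infer_instance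
  -- The factor `‖1‖` covers the trivial space, where the identity has norm 0.
  have hre : ∀ z : X, |(z : ℂ).re| ≤ ‖B‖ * ‖(1 : H →L[ℂ] H)‖ := fun z =>
    (Complex.abs_re_le_norm _).trans (spectrum.norm_le_norm_mul_of_mem z.2)
  set M : ℝ := ‖B‖ * ‖(1 : H →L[ℂ] H)‖
  have hae : ∀ᵐ t ∂ω, t ∈ Metric.closedBall (0 : ℝ) M := by
    refine (ae_map_iff hcont.aemeasurable Metric.isClosed_closedBall.measurableSet).mpr ?_
    exact Filter.Eventually.of_forall fun z => by simpa using hre z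
  let p : (ℝ →ᵇ ℂ) →ₗ[ℂ] C(X, ℂ) :=
    { toFun := fun g => ⟨fun z => g (z : ℂ).re, by fun_prop⟩
      map_add' := fun f g => rfl
      map_smul' := fun c f => rfl }
  -- This is g ↦ g(B)x. It is compared with the class of g in L²(ω): both maps have dense range and
  -- give the same norm, so their correspondence extends to a unitary.
  let L : (ℝ →ᵇ ℂ) →ₗ[ℂ] H :=
    { toFun := fun g => T (p g) x
      map_add' := fun f g => by simp
      map_smul' := fun c f => by simp }
  let c := truncatedId M
  have hpc : T (p c) = B := by
    rw [← hT]
    congr 1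
    ext z
    have h1 : c (z : ℂ).re = (z : ℂ).re := truncatedId_apply_of_abs_le (hre z)
    have h2 := hB.mem_spectrum_eq_re z.2
    simpa [p, h1] using h2.symm
  have hLc : ∀ g, L (c * g) = B (L g) := by
    intro g
    have : p (c * g) = p c * p g := rfl
    change T (p (c * g)) x = B (T (p g) x)
    rw [this, map_mul, hpc]
    rfl
  have hL1 : L 1 = x := by
    have : p 1 = 1 := rfl
    change T (p 1) x = x
    rw [this, map_one]
    rfl
  let e : (ℝ →ᵇ ℂ) →ₗ[ℂ] Lp ℂ 2 ω := (BoundedContinuousFunction.toLp 2 ω ℂ).toLinearMap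
  have he : ∀ g, e g =ᵐ[ω] g := fun g => BoundedContinuousFunction.coeFn_toLp 2 ω ℂ g
  have hed : DenseRange e :=
    BoundedContinuousFunction.toLp_denseRange ℂ ω ℂ (p := 2) (by simp)
  have hLd : DenseRange L := by
    have hsub : Submodule.span ℂ (Set.range fun n : ℕ => (B ^ n) x) ≤ LinearMap.range L := by
      rw [Submodule.span_le]
      rintro _ ⟨n, rfl⟩
      -- On the spectrum c is the identity, so cⁿ is a bounded stand-in for tⁿ and is sent to Bⁿx.
      refine ⟨c ^ n, ?_⟩
      induction n with
      | zero => simpa using hL1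
      | succ n ih => simp only [pow_succ', hLc, ih, mul_apply_eq_comp]
    have h := Submodule.topologicalClosure_mono hsub
    rw [hx, top_le_iff] at h
    exact (Submodule.dense_iff_topologicalClosure_eq_top.mpr h)
  have hnorm : ∀ g, ‖L g‖ = ‖e g‖ := by
    intro g
    have h1 : ‖e g‖ ^ 2 = ∫ t, ‖g t‖ ^ 2 ∂ω := by
      have := L2.inner_def (𝕜 := ℂ) (e g) (e g)
      rw [inner_self_eq_norm_sq_to_K] at this
      have h2 : ∫ t, inner ℂ (e g t) (e g t) ∂ω = ((∫ t, ‖g t‖ ^ 2 ∂ω : ℝ) : ℂ) := by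
        rw [← integral_complex_ofReal]
        refine integral_congr_ae ?_
        filter_upwards [he g] with t ht
        rw [ht, inner_self_eq_norm_sq_to_K]
        simp
      rw [h2] at this
      exact Complex.ofReal_injective (by rw [Complex.ofReal_pow]; exact this)
    have h2 : ∫ t, ‖g t‖ ^ 2 ∂ω = ∫ z : X, ‖p g z‖ ^ 2 ∂μ :=
      integral_map hcont.aemeasurable (by fun_prop)
    have h3 : ‖L g‖ ^ 2 = ‖e g‖ ^ 2 := by rw [h1, h2, ← hTμ]; rfl
    exact (pow_left_inj₀ (norm_nonneg _) (norm_nonneg _) two_ne_zero).mp h3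
  let W : Lp ℂ 2 ω ≃ₗᵢ[ℂ] H :=
    (LinearEquiv.refl ℂ (ℝ →ᵇ ℂ)).extendOfIsometry e L hed hLd hnorm
  have hW : ∀ g, W (e g) = L g := fun g =>
    LinearEquiv.extendOfIsometry_eq _ _ _ hed hLd hnorm g
  have hWB : ∀ F, W (lpMul ω c F) = B (W F) := by
    refine hed.induction ?_ (isClosed_eq (by fun_prop) (by fun_prop))
    rintro _ ⟨g, rfl⟩
    rw [hW, ← hLc, ← hW]
    congr 1
    refine Lp.ext ?_
    filter_upwards [coeFn_lpMul ω c (e g), he g, he (c * g)] with t h1 h2 h3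
    rw [h1, h2, h3]
    rfl
  refine ⟨ω, hω, ?_, W.symm, ?_, fun y => ?_⟩
  · exact (isCompact_closedBall (0 : ℝ) M).of_isClosed_subset Measure.isClosed_support
      (Measure.support_subset_of_isClosed Metric.isClosed_closedBall hae)
  · have : W.symm x = e 1 := by rw [W.symm_apply_eq, hW, hL1]
    rw [this]
    exact he 1
  · have : W.symm (B y) = lpMul ω c (W.symm y) := by
      rw [W.symm_apply_eq, hWB, W.apply_symm_apply]
    rw [this]
    filter_upwards [coeFn_lpMul ω c (W.symm y), hae] with t h1 h2
    rw [h1, truncatedId_apply_of_abs_le (by simpa using h2)]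

end SpectralTheorem

/-! ### Consequences of a unitary that sends the cyclic vector to 1 -/

section Unitary

variable {H : Type*} [NormedAddCommGroup H] [InnerProductSpace ℂ H]

/-- The spectral representation of the resolvent form at a vector represented by `1`. -/
theorem inner_eq_integral_of_unitary {B : H →L[ℂ] H} {ω : Measure ℝ} (U : H ≃ₗᵢ[ℂ] Lp ℂ 2 ω)
    (hU : ∀ y, U (B y) =ᵐ[ω] fun t : ℝ => (t : ℂ) * U y t) {x y : H}
    (hx : U x =ᵐ[ω] fun _ => 1) {z : ℂ} (hz : z.im ≠ 0) (h : B y - z • y = x) :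
    inner ℂ x y = ∫ t : ℝ, ((t : ℂ) - z)⁻¹ ∂ω := by
  rw [← U.inner_map_map, L2.inner_def]
  refine integral_congr_ae ?_
  -- In L²(ω) the equation reads (t - z)·Uy = 1, which determines Uy almost everywhere.
  have h1 : U (B y) - z • U y = U x := by rw [← h, map_sub, map_smul]
  have h2 := Lp.coeFn_sub (U (B y)) (z • U y)
  rw [h1] at h2
  filter_upwards [h2, hU y, hx, Lp.coeFn_smul z (U y)] with t h3 h4 h5 h6
  have hne : (t : ℂ) - z ≠ 0 := fun h0 => hz (by simpa using congrArg Complex.im h0)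
  rw [Pi.sub_apply, h4, h5, h6, Pi.smul_apply, smul_eq_mul, ← sub_mul] at h3
  rw [h5, eq_inv_of_mul_eq_one_right h3.symm]
  simp

theorem measure_univ_eq_of_unitary {ω : Measure ℝ} [IsFiniteMeasure ω] (U : H ≃ₗᵢ[ℂ] Lp ℂ 2 ω)
    {x : H} (hx : U x =ᵐ[ω] fun _ => 1) : ω Set.univ = ENNReal.ofReal (‖x‖ ^ 2) := by
  have h1 : (inner ℂ x x : ℂ) = (ω.real Set.univ : ℝ) := by
    rw [← U.inner_map_map, L2.inner_def, integral_congr_ae (g := fun _ => (1 : ℂ))]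
    · simp
    · filter_upwards [hx] with t ht
      rw [ht]
      simp
  rw [inner_self_eq_norm_sq_to_K] at h1
  have h2 : ‖x‖ ^ 2 = ω.real Set.univ := Complex.ofReal_injective (by rw [Complex.ofReal_pow]; exact h1)
  rw [h2, ofReal_measureReal]

end Unitary

/-! ### Resolvents of self-adjoint operators off the real axis -/

section SelfAdjoint

variable {H : Type*} [NormedAddCommGroup H] [InnerProductSpace ℂ H] [CompleteSpace H]

/-- Since ⟨Bx, x⟩ is real, only the term -z̄‖x‖² contributes. Injectivity of B - z, the nonvanishing
denominator and the Herglotz property all rest on this identity. -/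
theorem im_inner_of_sub_smul_eq {B : H →L[ℂ] H} (hB : IsSelfAdjoint B) {z : ℂ} {x y : H}
    (h : B x - z • x = y) : (inner ℂ y x).im = z.im * ‖x‖ ^ 2 := by
  have h1 : (inner ℂ (B x) x).im = 0 := by
    apply Complex.conj_eq_iff_im.mp
    rw [inner_conj_symm]
    exact (hB.isSymmetric x x).symm
  rw [← h, inner_sub_left, inner_smul_left, inner_self_eq_norm_sq_to_K, Complex.sub_im, h1]
  simp [← Complex.ofReal_pow]

theorem eq_zero_of_apply_eq_smul {B : H →L[ℂ] H} (hB : IsSelfAdjoint B) {z : ℂ} (hz : z.im ≠ 0)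
    {x : H} (h : B x - z • x = 0) : x = 0 := by
  have := im_inner_of_sub_smul_eq hB h
  simpa [hz] using this

theorem isUnit_sub_smul_id {B : H →L[ℂ] H} (hB : IsSelfAdjoint B) {z : ℂ} (hz : z.im ≠ 0) :
    IsUnit (B - z • ContinuousLinearMap.id ℂ H) := by
  have h : z ∉ spectrum ℂ B := fun h => hz (by rw [hB.mem_spectrum_eq_re h, Complex.ofReal_im])
  have h' := (spectrum.notMem_iff.mp h).neg
  rwa [neg_sub, Algebra.algebraMap_eq_smul_one] at h'

theorem sub_smul_inverse_apply {B : H →L[ℂ] H} (hB : IsSelfAdjoint B) {z : ℂ} (hz : z.im ≠ 0)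
    (x : H) :
    B (Ring.inverse (B - z • ContinuousLinearMap.id ℂ H) x) -
      z • Ring.inverse (B - z • ContinuousLinearMap.id ℂ H) x = x := by
  have h := congrArg (fun S : H →L[ℂ] H => S x)
    (Ring.mul_inverse_cancel _ (isUnit_sub_smul_id hB hz))
  simpa using h

theorem im_resolventForm {B : H →L[ℂ] H} (hB : IsSelfAdjoint B) {z : ℂ} (hz : z.im ≠ 0) (v : H) :
    (resolventForm B v z).im =
      z.im * ‖Ring.inverse (B - z • ContinuousLinearMap.id ℂ H) v‖ ^ 2 :=
  im_inner_of_sub_smul_eq hB (sub_smul_inverse_apply hB hz v)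

/-- The imaginary part of the denominator is -Im z · (1 + ‖(B - z)⁻¹v‖²). -/
theorem sub_resolventForm_ne_zero {B : H →L[ℂ] H} (hB : IsSelfAdjoint B) {z : ℂ} (hz : z.im ≠ 0)
    (a : ℝ) (v : H) : (a : ℂ) - z - resolventForm B v z ≠ 0 := by
  intro h
  have h1 := congrArg Complex.im h
  rw [Complex.sub_im, Complex.sub_im, im_resolventForm hB hz, Complex.ofReal_im,
    Complex.zero_im] at h1
  have h2 : z.im * (1 + ‖Ring.inverse (B - z • ContinuousLinearMap.id ℂ H) v‖ ^ 2) = 0 := by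
    linarith
  rcases mul_eq_zero.mp h2 with h3 | h3
  · exact hz h3
  · exact absurd h3 (by positivity)

theorem differentiableAt_resolventForm {B : H →L[ℂ] H} (hB : IsSelfAdjoint B) {z : ℂ}
    (hz : z.im ≠ 0) (v : H) : DifferentiableAt ℂ (resolventForm B v) z := by
  have h1 : DifferentiableAt ℂ
      (fun w : ℂ => Ring.inverse (B - w • ContinuousLinearMap.id ℂ H)) z := by
    have h2 : DifferentiableAt ℂ (fun w : ℂ => B - w • ContinuousLinearMap.id ℂ H) z := by
      fun_prop
    have h3 : DifferentiableAt ℂ (Ring.inverse (M₀ := H →L[ℂ] H))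
        (B - z • ContinuousLinearMap.id ℂ H) :=
      differentiableAt_inverse (isUnit_sub_smul_id hB hz)
    exact h3.comp z h2
  have h4 : DifferentiableAt ℂ
      (fun w : ℂ => Ring.inverse (B - w • ContinuousLinearMap.id ℂ H) v) z :=
    h1.clm_apply (differentiableAt_const v)
  exact (innerSL ℂ v).differentiableAt.comp z h4

theorem differentiableAt_phi {B : H →L[ℂ] H} (hB : IsSelfAdjoint B) {z : ℂ}
    (hz : z.im ≠ 0) (a : ℝ) (v : H) : DifferentiableAt ℂ (phi B a v) z := by
  have h := differentiableAt_resolventForm hB hz v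
  unfold phi
  refine DifferentiableAt.div ?_ ?_ (sub_resolventForm_ne_zero hB hz a v)
  · fun_prop
  · fun_prop

/-- A vector is cyclic if no nonzero vector has an orbit orthogonal to it. -/
theorem topologicalClosure_span_orbit_eq_top {B : H →L[ℂ] H} (hB : IsSelfAdjoint B) {x : H}
    (h : ∀ y, (∀ n : ℕ, inner ℂ x ((B ^ n) y) = 0) → y = 0) :
    (Submodule.span ℂ (Set.range fun n : ℕ => (B ^ n) x)).topologicalClosure = ⊤ := by
  rw [Submodule.topologicalClosure_eq_top_iff, Submodule.eq_bot_iff]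
  intro y hy
  refine h y fun n => ?_
  have h1 := (Submodule.mem_orthogonal _ y).mp hy _ (Submodule.subset_span ⟨n, rfl⟩)
  rw [← h1]
  exact ((hB.pow n).isSymmetric x y).symm

end SelfAdjoint

/-! ### The block operator and its cyclic vector (v, i) -/

section Block

/-- The vector `(v, i)`, whose spectral measure for the block operator is represented by `phi`. -/
def blockCyclicVector {E : Type*} [NormedAddCommGroup E] (v : E) :
    WithLp 2 (E × ℂ) := WithLp.toLp 2 (v, Complex.I)

theorem norm_sq_blockCyclicVector {E : Type*} [NormedAddCommGroup E] (v : E) :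
    ‖blockCyclicVector v‖ ^ 2 = 1 + ‖v‖ ^ 2 := by
  rw [WithLp.prod_norm_sq_eq_of_L2]
  simp [blockCyclicVector, add_comm]

variable {H₀ : Type*} [NormedAddCommGroup H₀] [InnerProductSpace ℂ H₀] [CompleteSpace H₀]
  {A₀ : H₀ →L[ℂ] H₀} {A₁ : ℂ →L[ℂ] ℂ} {V : ℂ →L[ℂ] H₀}

theorem blockOperator_toLp_complex (A₀ : H₀ →L[ℂ] H₀) (hA₁ : IsSelfAdjoint A₁) (V : ℂ →L[ℂ] H₀)
    (x : H₀) (c : ℂ) :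
    blockOperator A₀ A₁ V (WithLp.toLp 2 (x, c)) =
      WithLp.toLp 2 (A₀ x + c • couplingVector V,
        inner ℂ (couplingVector V) x + multiplier A₁ * c) := by
  have h : V c = c • couplingVector V := by simpa [couplingVector] using V.map_smul c 1
  rw [blockOperator_toLp, adjoint_apply_eq_inner_couplingVector, apply_eq_multiplier_mul A₁ hA₁, h]

theorem isSelfAdjoint_blockOperator (hA₀ : IsSelfAdjoint A₀) (hA₁ : IsSelfAdjoint A₁)
    (V : ℂ →L[ℂ] H₀) : IsSelfAdjoint (blockOperator A₀ A₁ V) := by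
  rw [ContinuousLinearMap.isSelfAdjoint_iff_isSymmetric]
  rintro ⟨x, c⟩ ⟨y, d⟩
  have h : inner ℂ (A₀ x) y = inner ℂ x (A₀ y) := hA₀.isSymmetric x y
  have h' : inner ℂ (A₁ c) d = inner ℂ c (A₁ d) := hA₁.isSymmetric c d
  change inner ℂ (blockOperator A₀ A₁ V (WithLp.toLp 2 (x, c))) (WithLp.toLp 2 (y, d)) =
    inner ℂ (WithLp.toLp 2 (x, c)) (blockOperator A₀ A₁ V (WithLp.toLp 2 (y, d)))
  simp only [blockOperator_toLp, WithLp.prod_inner_apply, inner_add_left, inner_add_right, h, h',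
    ContinuousLinearMap.adjoint_inner_left, ContinuousLinearMap.adjoint_inner_right]
  ring

theorem exists_blockOperator_sub_smul_eq (hA₀ : IsSelfAdjoint A₀) (hA₁ : IsSelfAdjoint A₁)
    (V : ℂ →L[ℂ] H₀) {z : ℂ} (hz : z.im ≠ 0) :
    ∃ y, blockOperator A₀ A₁ V y - z • y = blockCyclicVector (couplingVector V) ∧
      inner ℂ (blockCyclicVector (couplingVector V)) y =
        phi A₀ (multiplier A₁) (couplingVector V) z := by
  have hD := sub_resolventForm_ne_zero hA₀ hz (multiplier A₁) (couplingVector V)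
  have hr := sub_smul_inverse_apply hA₀ hz (couplingVector V)
  have hm : inner ℂ (couplingVector V) (Ring.inverse (A₀ - z • ContinuousLinearMap.id ℂ H₀)
    (couplingVector V)) = resolventForm A₀ (couplingVector V) z := rfl
  unfold phi
  set v := couplingVector V with hv
  set m := resolventForm A₀ v z
  set r := Ring.inverse (A₀ - z • ContinuousLinearMap.id ℂ H₀) v
  set a : ℂ := (multiplier A₁ : ℂ)
  -- With r = (A₀ - z)⁻¹v, the first row forces the first component (1 - c)r. The second row becomes
  -- (1 - c)m + (a - z)c = i, which gives this c.
  obtain ⟨c, hc⟩ : ∃ c, c = (Complex.I - m) / (a - z - m) := ⟨_, rfl⟩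
  have hcD : c * (a - z - m) = Complex.I - m := by rw [hc, div_mul_cancel₀ _ hD]
  refine ⟨WithLp.toLp 2 ((1 - c) • r, c), ?_, ?_⟩
  · rw [blockOperator_toLp_complex _ hA₁, ← WithLp.toLp_smul, ← WithLp.toLp_sub,
      blockCyclicVector, ← hv]
    congr 1
    refine Prod.ext ?_ ?_
    · have : A₀ r = v + z • r := by rw [← sub_eq_iff_eq_add]; exact hr
      simp only [Prod.fst_sub, Prod.smul_fst, map_smul, this]
      module
    · simp only [Prod.snd_sub, Prod.smul_snd, inner_smul_right, hm, smul_eq_mul]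
      linear_combination hcD
  · rw [WithLp.prod_inner_apply]
    simp only [blockCyclicVector, inner_smul_right, hm]
    rw [eq_div_iff hD]
    simp only [RCLike.inner_apply, Complex.conj_I]
    -- The numerator of φ appears through (i - m)(-i - m) = 1 + m².
    linear_combination (-Complex.I - m) * hcD - Complex.I_sq

theorem eq_zero_of_inner_couplingVector_orbit (hA₀ : IsSelfAdjoint A₀)
    (hcyc : cyclicSubspace A₀ V.range = ⊤) {x : H₀}
    (h : ∀ n : ℕ, inner ℂ (couplingVector V) ((A₀ ^ n) x) = 0) : x = 0 := by
  rw [cyclicSubspace, Submodule.topologicalClosure_eq_top_iff, Submodule.eq_bot_iff] at hcyc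
  refine hcyc x ?_
  rw [Submodule.mem_orthogonal]
  intro y hy
  induction hy using Submodule.span_induction with
  | zero => simp
  | add y y' _ _ h1 h2 => rw [inner_add_left, h1, h2, add_zero]
  | smul c y _ h1 => rw [inner_smul_left, h1, mul_zero]
  | mem y hy =>
    obtain ⟨n, s, ⟨c, rfl⟩, rfl⟩ := hy
    have hc : V c = c • couplingVector V := by simpa [couplingVector] using V.map_smul c 1
    have h1 : inner ℂ ((A₀ ^ n) (couplingVector V)) x = 0 :=
      ((hA₀.pow n).isSymmetric (couplingVector V) x).trans (h n)
    change inner ℂ ((A₀ ^ n) (V c)) x = 0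
    rw [hc, map_smul, inner_smul_left, h1, mul_zero]

/-- This is the cyclicity of (0, 1). An orbit with zero second component stays in H₀, where B acts
as A₀; the second component of the next iterate is then ⟨v, A₀ⁿx⟩, and cyclicity of v gives x = 0.
-/
theorem eq_zero_of_snd_orbit_blockOperator (hA₀ : IsSelfAdjoint A₀) (hA₁ : IsSelfAdjoint A₁)
    (hcyc : cyclicSubspace A₀ V.range = ⊤) {y : WithLp 2 (H₀ × ℂ)}
    (h : ∀ n : ℕ, ((blockOperator A₀ A₁ V ^ n) y).snd = 0) : y = 0 := by
  obtain ⟨x, c⟩ := y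
  obtain rfl : c = 0 := h 0
  have key : ∀ n : ℕ, (blockOperator A₀ A₁ V ^ n) (WithLp.toLp 2 (x, 0)) =
      WithLp.toLp 2 ((A₀ ^ n) x, 0) := by
    intro n
    induction n with
    | zero => rfl
    | succ n ih =>
      have h1 := h (n + 1)
      rw [pow_succ', mul_apply_eq_comp, ih, blockOperator_toLp_complex _ hA₁] at h1
      rw [pow_succ', mul_apply_eq_comp, ih, blockOperator_toLp_complex _ hA₁, pow_succ',
        mul_apply_eq_comp, zero_smul, add_zero]
      congr 2
  have hx : x = 0 := by
    refine eq_zero_of_inner_couplingVector_orbit hA₀ hcyc fun n => ?_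
    have h1 := h (n + 1)
    rw [pow_succ', mul_apply_eq_comp, key, blockOperator_toLp_complex _ hA₁] at h1
    simpa using h1
  rw [hx]
  rfl

/-- Since (v, i) = (B - (a₁ - i))(0, 1), a vector y whose orbit is orthogonal to (v, i) makes the
orbit of (B - (a₁ + i))y orthogonal to (0, 1). Hence (B - (a₁ + i))y = 0, and y = 0 because a₁ + i
is not real. -/
theorem blockCyclicVector_cyclic (hA₀ : IsSelfAdjoint A₀) (hA₁ : IsSelfAdjoint A₁)
    (hcyc : cyclicSubspace A₀ V.range = ⊤) :
    (Submodule.span ℂ (Set.range fun n : ℕ => (blockOperator A₀ A₁ V ^ n)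
      (blockCyclicVector (couplingVector V)))).topologicalClosure = ⊤ := by
  have hB := isSelfAdjoint_blockOperator hA₀ hA₁ V
  refine topologicalClosure_span_orbit_eq_top hB fun y hy => ?_
  have hz : ((multiplier A₁ : ℂ) + Complex.I).im ≠ 0 := by simp
  refine eq_zero_of_apply_eq_smul hB hz ?_
  refine eq_zero_of_snd_orbit_blockOperator hA₀ hA₁ hcyc fun n => ?_
  have h1 : (blockOperator A₀ A₁ V ^ n) (blockOperator A₀ A₁ V y) =
      blockOperator A₀ A₁ V ((blockOperator A₀ A₁ V ^ n) y) := by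
    rw [← mul_apply_eq_comp, ← mul_apply_eq_comp, ← pow_succ, ← pow_succ']
  have h2 := hy n
  rw [map_sub, map_smul, h1]
  obtain ⟨⟨x, c⟩, hw⟩ : ∃ w, (blockOperator A₀ A₁ V ^ n) y = WithLp.toLp 2 w := ⟨_, rfl⟩
  rw [hw, blockCyclicVector, WithLp.prod_inner_apply] at h2
  rw [hw, blockOperator_toLp_complex _ hA₁]
  simp only [RCLike.inner_apply, Complex.conj_I] at h2
  change inner ℂ (couplingVector V) x + multiplier A₁ * c -
    ((multiplier A₁ : ℂ) + Complex.I) * c = 0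
  linear_combination h2

end Block

theorem theorem3p2 {H₀ : Type*} [NormedAddCommGroup H₀] [InnerProductSpace ℂ H₀]
    [CompleteSpace H₀]
    (A₀ : H₀ →L[ℂ] H₀) (hA₀ : IsSelfAdjoint A₀)
    (A₁ : ℂ →L[ℂ] ℂ) (hA₁ : IsSelfAdjoint A₁)
    (V : ℂ →L[ℂ] H₀)
    (hcyc : cyclicSubspace A₀ V.range = ⊤) :
    IsHerglotz (phi A₀ (multiplier A₁) (couplingVector V)) ∧
    ∃ ω : Measure ℝ,
      ω Set.univ = ENNReal.ofReal (1 + ‖couplingVector V‖ ^ 2) ∧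
      IsCompact ω.support ∧
      (∀ z : ℂ, z.im ≠ 0 →
        multiplier A₁ - z - resolventForm A₀ (couplingVector V) z ≠ 0 ∧
        phi A₀ (multiplier A₁) (couplingVector V) z = ∫ t : ℝ, ((t : ℂ) - z)⁻¹ ∂ω) ∧
      IsUnitarilyEquivalentToMul (blockOperator A₀ A₁ V) ω := by
  have hB := isSelfAdjoint_blockOperator hA₀ hA₁ V
  refine ⟨⟨fun z hz => ?_, fun z hz => ?_⟩, ?_⟩
  · exact (differentiableAt_phi hA₀ (ne_of_gt hz) _ _).differentiableWithinAt
  · obtain ⟨y, hy, hphi⟩ := exists_blockOperator_sub_smul_eq hA₀ hA₁ V hz.ne'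
    rw [← hphi, im_inner_of_sub_smul_eq hB hy]
    -- If y = 0 then (v, i) = 0, although its squared norm is at least 1.
    have hy0 : y ≠ 0 := by
      rintro rfl
      have h := norm_sq_blockCyclicVector (couplingVector V)
      rw [← hy] at h
      simp only [map_zero, smul_zero, sub_zero, norm_zero] at h
      nlinarith [sq_nonneg ‖couplingVector V‖]
    have := norm_pos_iff.mpr hy0
    positivity
  · obtain ⟨ω, hω, hsupp, U, hU1, hU⟩ := exists_unitary_mul_of_cyclic (blockOperator A₀ A₁ V) hB
      (blockCyclicVector (couplingVector V)) (blockCyclicVector_cyclic hA₀ hA₁ hcyc)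
    refine ⟨ω, ?_, hsupp, fun z hz => ⟨sub_resolventForm_ne_zero hA₀ hz _ _, ?_⟩, U, hU⟩
    · rw [measure_univ_eq_of_unitary U hU1, norm_sq_blockCyclicVector]
    · obtain ⟨y, hy, hphi⟩ := exists_blockOperator_sub_smul_eq hA₀ hA₁ V hz
      rw [← hphi, inner_eq_integral_of_unitary U hU hU1 hz hy]

end
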